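/- Let $\mathsf{PA}$ be the set of axioms of first-order Peano arithmetic. For a finite nonempty set $A\subset\mathbb N$ represented by an arithmetical formula $A(x)$ (that is, $\mathsf{PA}\vdash A(\bar n)$ for $n\in A$, $\mathsf{PA}\vdash\lnot A(\bar n)$ for $n\notin A$, and $\mathsf{PA}$ proves that exactly $\#A$ numbers satisfy $A(x)$), an arithmetical formula $R(x)$ with one free variable and a rational $\tau\ge 0$, let $(\forall_\tau x\in A)\,R(x)$ be the arithmetical sentence stating that the proportion of those members of $A$ for which $R$ fails is at most $\tau$. A \emph{proof strategy} with initial capital $\varepsilon$ is a finite tree whose nodes are labeled by pairs $(T,\delta)$, where $T$ is a set of arithmetical sentences and $\delta\ge 0$ is a rational. The root has label $(\mathsf{PA},\varepsilon)$. Every node that is not a leaf is of one of two kinds. A deterministic node with label $(T,\delta)$ has one child, with label $(T\cup\{\psi\},\delta)$, where $\psi$ is a logical axiom or is obtained from $T$ by one application of an inference rule. A probabilistic node with label $(T,\delta)$ comes with some $A$, $R$ and $\tau\le\delta$ as above such that the sentence $(\forall_\tau x\in A)\,R(x)$ belongs to $T$; it has one child for each $n\in A$, with label $(T\cup\{R(\bar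 n)\},\delta-\tau)$. Walk from the root to a leaf, choosing a child uniformly at random at each probabilistic node; the probability that the strategy proves $\varphi$ is the probability that $\varphi\in T$, where $(T,\delta)$ is the label of the leaf that is reached. \textbf{Theorem.} Let $\varphi$ be an arithmetical sentence and $\varepsilon\ge 0$ a rational. If some proof strategy with initial capital $\varepsilon$ proves $\varphi$ with probability greater than $\varepsilon$, then $\mathsf{PA}\vdash\varphi$. -/

import Mathlib

namespace RandomAxioms

open FirstOrder FirstOrder.Language

/-! ### The language of arithmetic -/

/-- Function symbols of first-order arithmetic: `0`, `S`, `+`, `·`. -/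
inductive ArithFunc : ℕ → Type
  | zero : ArithFunc 0
  | succ : ArithFunc 1
  | add : ArithFunc 2
  | mul : ArithFunc 2

/-- The first-order language of arithmetic, with equality as its only predicate. -/
def arith : Language where
  Functions := ArithFunc
  Relations := fun _ => Empty

/-- Terms in the variables `x₀, …, xₙ₋₁`. -/
abbrev Tm (n : ℕ) := arith.Term (Empty ⊕ Fin n)

/-- Arithmetical formulas whose free variables are among `x₀, …, xₙ₋₁`. -/
abbrev Fm (n : ℕ) := arith.BoundedFormula Empty n

/-- The variable `xᵢ`. -/
def tvar {n : ℕ} (i : Fin n) : Tm n := Term.var (Sum.inr i)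

def tzero {n : ℕ} : Tm n := Term.func (L := arith) ArithFunc.zero ![]

def tsucc {n : ℕ} (t : Tm n) : Tm n := Term.func (L := arith) ArithFunc.succ ![t]

def tadd {n : ℕ} (t u : Tm n) : Tm n := Term.func (L := arith) ArithFunc.add ![t, u]

def tmul {n : ℕ} (t u : Tm n) : Tm n := Term.func (L := arith) ArithFunc.mul ![t, u]

/-- The numeral `S (S (… 0))` of `k`. -/
def numeral {n : ℕ} : ℕ → Tm n
  | 0 => tzero
  | k + 1 => tsucc (numeral k)

/-! ### Substitution -/

/-- Substitution of the terms `σ i` for the variables of a term. -/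
def substTm {n m : ℕ} (σ : Fin n → Tm m) (t : Tm n) : Tm m :=
  t.subst (Sum.elim Empty.elim σ)

/-- A term, viewed with one more variable in scope. -/
def weakenTm {n : ℕ} (t : Tm n) : Tm (n + 1) := substTm (fun i => tvar i.castSucc) t

/-- Extends a substitution below a quantifier, which binds the last variable. -/
def liftSubst {n m : ℕ} (σ : Fin n → Tm m) : Fin (n + 1) → Tm (m + 1) :=
  Fin.snoc (α := fun _ => Tm (m + 1)) (fun i => weakenTm (σ i)) (tvar (Fin.last m))

/-- Simultaneous capture-avoiding substitution of the terms `σ i` for the free variables `xᵢ`. -/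
def subst : {n m : ℕ} → Fm n → (Fin n → Tm m) → Fm m
  | _, _, .falsum, _ => .falsum
  | _, _, .equal t u, σ => .equal (substTm σ t) (substTm σ u)
  | _, _, .rel r ts, σ => .rel r fun i => substTm σ (ts i)
  | _, _, .imp φ ψ, σ => .imp (subst φ σ) (subst ψ σ)
  | _, _, .all φ, σ => .all (subst φ (liftSubst σ))

/-- A formula, viewed with one more variable in scope. -/
def weaken {n : ℕ} (φ : Fm n) : Fm (n + 1) := subst φ fun i => tvar i.castSucc

/-- `φ[t]`: substitution of `t` for the last free variable of `φ`. -/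
def inst {n : ℕ} (φ : Fm (n + 1)) (t : Tm n) : Fm n :=
  subst φ (Fin.snoc (α := fun _ => Tm n) tvar t)

/-- `φ[S x]` where `x` is the last free variable of `φ`, which stays free. -/
def instSucc {n : ℕ} (φ : Fm (n + 1)) : Fm (n + 1) :=
  subst φ (Fin.snoc (α := fun _ => Tm (n + 1)) (fun i => tvar i.castSucc)
    (tsucc (tvar (Fin.last n))))

/-- The formula `ψ(t)`, for a formula `ψ` with one free variable. -/
def app {n : ℕ} (ψ : Fm 1) (t : Tm n) : Fm n := subst ψ fun _ => t

/-! ### First-order proofs -/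

/-- The logical axioms of a Hilbert calculus with equality: all universal closures of the usual
schemes. As closures are axioms, modus ponens is the only inference rule that is needed, and
proofs consist of sentences. -/
inductive LogicalAxiom : arith.Sentence → Prop
  | imp_k {n : ℕ} (φ ψ : Fm n) : LogicalAxiom (φ.imp (ψ.imp φ)).alls
  | imp_s {n : ℕ} (φ ψ χ : Fm n) :
      LogicalAxiom ((φ.imp (ψ.imp χ)).imp ((φ.imp ψ).imp (φ.imp χ))).alls
  | dne {n : ℕ} (φ : Fm n) : LogicalAxiom (φ.not.not.imp φ).alls
  | all_inst {n : ℕ} (φ : Fm (n + 1)) (t : Tm n) : LogicalAxiom (φ.all.imp (inst φ t)).alls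
  | all_imp {n : ℕ} (φ ψ : Fm (n + 1)) :
      LogicalAxiom ((φ.imp ψ).all.imp (φ.all.imp ψ.all)).alls
  | all_vacuous {n : ℕ} (φ : Fm n) : LogicalAxiom (φ.imp (weaken φ).all).alls
  | eq_refl {n : ℕ} (t : Tm n) : LogicalAxiom (t.bdEqual t).alls
  | eq_subst {n : ℕ} (φ : Fm (n + 1)) (t u : Tm n) :
      LogicalAxiom ((t.bdEqual u).imp ((inst φ t).imp (inst φ u))).alls

/-- `ψ` is obtained from the formulas in `T` in one step: it is a logical axiom, or the result of
modus ponens. -/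
def OneStep (T : arith.Theory) (ψ : arith.Sentence) : Prop :=
  LogicalAxiom ψ ∨ ∃ χ ∈ T, χ.imp ψ ∈ T

/-- `T ⊢ φ`: there is a first-order proof of `φ` from the axioms `T`. -/
inductive Proves (T : arith.Theory) : arith.Sentence → Prop
  | ax {φ : arith.Sentence} : φ ∈ T → Proves T φ
  | logical {φ : arith.Sentence} : LogicalAxiom φ → Proves T φ
  | mp {φ ψ : arith.Sentence} : Proves T (φ.imp ψ) → Proves T φ → Proves T ψ

/-! ### Peano arithmetic -/

/-- The axioms of first-order Peano arithmetic (induction for all formulas, with parameters). -/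
inductive PAAxiom : arith.Sentence → Prop
  | succ_ne_zero : PAAxiom ((tsucc (tvar (n := 1) 0)).bdEqual tzero).not.alls
  | succ_inj : PAAxiom (((tsucc (tvar (n := 2) 0)).bdEqual (tsucc (tvar 1))).imp
      ((tvar 0).bdEqual (tvar 1))).alls
  | add_zero : PAAxiom ((tadd (tvar (n := 1) 0) tzero).bdEqual (tvar 0)).alls
  | add_succ : PAAxiom ((tadd (tvar (n := 2) 0) (tsucc (tvar 1))).bdEqual
      (tsucc (tadd (tvar 0) (tvar 1)))).alls
  | mul_zero : PAAxiom ((tmul (tvar (n := 1) 0) tzero).bdEqual tzero).alls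
  | mul_succ : PAAxiom ((tmul (tvar (n := 2) 0) (tsucc (tvar 1))).bdEqual
      (tadd (tmul (tvar 0) (tvar 1)) (tvar 0))).alls
  | induction {n : ℕ} (φ : Fm (n + 1)) :
      PAAxiom ((inst φ tzero).imp ((φ.imp (instSucc φ)).all.imp φ.all)).alls

/-- Peano arithmetic, as a set of sentences. -/
def PA : arith.Theory := {φ | PAAxiom φ}

/-! ### Counting in arithmetic -/

/-- Pairs of distinct indices below `m`. -/
abbrev IdxPair (m : ℕ) := {p : Fin m × Fin m // p.1 < p.2}

/-- The sentence “there are at least `m` numbers `x` with `ψ(x)`”. -/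
noncomputable def atLeast (m : ℕ) (ψ : Fm 1) : arith.Sentence :=
  BoundedFormula.exs (n := m)
    (BoundedFormula.iInf (fun i : Fin m => app ψ (tvar i)) ⊓
      BoundedFormula.iInf (fun p : IdxPair m => ((tvar p.1.1).bdEqual (tvar p.1.2)).not))

/-- The sentence “there are at most `k` numbers `x` with `ψ(x)`”: among any `k + 1` numbers with
this property two are equal. -/
noncomputable def atMost (k : ℕ) (ψ : Fm 1) : arith.Sentence :=
  BoundedFormula.alls (n := k + 1)
    ((BoundedFormula.iInf (fun i : Fin (k + 1) => app ψ (tvar i))).imp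
      (BoundedFormula.iSup
        (fun p : IdxPair (k + 1) => (tvar p.1.1).bdEqual (tvar p.1.2))))

/-- The finite set `A` of natural numbers is represented by the formula `α(x)`: `PA` decides
membership of every number correctly and proves that exactly `#A` numbers satisfy `α`. -/
structure Represents (α : Fm 1) (A : Finset ℕ) : Prop where
  proves_mem : ∀ n ∈ A, Proves PA (app α (numeral n))
  proves_not_mem : ∀ n ∉ A, Proves PA (app α (numeral n)).not
  proves_card : Proves PA (atLeast A.card α ⊓ atMost A.card α)

/-- The sentence `(∀_τ x ∈ A) R(x)`, for a set `A` represented by `α`: the proportion of those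
members of `A` for which `R` fails is at most `τ`, i.e. at most `⌊τ · #A⌋` numbers `x` satisfy
`α(x) ∧ ¬R(x)`. -/
noncomputable def mostlyAll (τ : ℚ) (A : Finset ℕ) (α R : Fm 1) : arith.Sentence :=
  atMost ⌊τ * (A.card : ℚ)⌋₊ (α ⊓ R.not)

/-! ### Probabilistic proof strategies -/

/-- The (finite) tree of a proof strategy whose root has label `(T, δ)`: `T` is the set of
sentences obtained so far and `δ` the current capital. -/
inductive Strategy : arith.Theory → ℚ → Type
  | leaf (T : arith.Theory) (δ : ℚ) : Strategy T δ
  | deterministic {T : arith.Theory} {δ : ℚ} (ψ : arith.Sentence) (hψ : OneStep T ψ)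
      (child : Strategy (T ∪ {ψ}) δ) : Strategy T δ
  | probabilistic {T : arith.Theory} {δ : ℚ} (A : Finset ℕ) (hA : A.Nonempty) (α R : Fm 1)
      (hα : Represents α A) (τ : ℚ) (hτ : 0 ≤ τ) (hτδ : τ ≤ δ) (hT : mostlyAll τ A α R ∈ T)
      (child : ∀ n : A, Strategy (T ∪ {app R (numeral n)}) (δ - τ)) : Strategy T δ

/-- The theory built by a strategy, as a random variable (given by its law): walk from the root
to a leaf, choosing a child uniformly at every probabilistic node. -/
noncomputable def Strategy.builtTheory :
    {T : arith.Theory} → {δ : ℚ} → Strategy T δ → PMF arith.Theory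
  | _, _, .leaf T _ => PMF.pure T
  | _, _, .deterministic _ _ child => child.builtTheory
  | _, _, .probabilistic A hA _ _ _ _ _ _ _ child =>
    haveI : Nonempty A := hA.to_subtype
    (PMF.uniformOfFintype A).bind fun n => (child n).builtTheory

/-- The probability that the strategy proves `φ`: the total probability of the leaves at which
`φ` appears. -/
noncomputable def Strategy.probProves {T : arith.Theory} {δ : ℚ} (π : Strategy T δ)
    (φ : arith.Sentence) : ENNReal :=
  π.builtTheory.toOuterMeasure {T' | φ ∈ T'}

end RandomAxioms

namespace RandomAxioms

open FirstOrder FirstOrder.Language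

/-! ### Substitution -/

/-! The claim is proved for every theory T ⊇ PA and capital δ, by induction on the strategy tree. At
a leaf the probability is 0 or 1, so a positive one puts φ in T. At a deterministic node the new
sentence is already a theorem of T, hence can be cut. At a probabilistic node the success
probability is the average of the children's. If it exceeds δ, then more than τ·#A children n have
probability above δ - τ (`lt_card_filter_of_lt_average`), and by induction T + R(n) proves φ for
each of them. So T + ¬φ refutes R(n) for more than τ·#A members of A. As PA proves distinct numerals
different, this contradicts (∀_τ x ∈ A) R(x), which T contains; hence T proves φ
(`Proves.of_mostlyAll`). -/

theorem substTm_tvar {n m : ℕ} (σ : Fin n → Tm m) (i : Fin n) : substTm σ (tvar i) = σ i := rfl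

theorem substTm_substTm {n m l : ℕ} (σ : Fin n → Tm m) (ρ : Fin m → Tm l) (t : Tm n) :
    substTm ρ (substTm σ t) = substTm (fun i => substTm ρ (σ i)) t := by
  induction t with
  | var a =>
    rcases a with a | a
    · exact a.elim
    · rfl
  | func f ts ih => exact congrArg (Term.func f) (funext ih)

theorem substTm_id {n : ℕ} (t : Tm n) : substTm tvar t = t := by
  induction t with
  | var a =>
    rcases a with a | a
    · exact a.elim
    · rfl
  | func f ts ih => exact congrArg (Term.func f) (funext ih)

theorem substTm_tsucc {n m : ℕ} (σ : Fin n → Tm m) (t : Tm n) :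
    substTm σ (tsucc t) = tsucc (substTm σ t) := by
  refine congrArg (Term.func (L := arith) ArithFunc.succ) (funext fun i => ?_)
  fin_cases i
  rfl

theorem substTm_tzero {n m : ℕ} (σ : Fin n → Tm m) : substTm σ tzero = tzero :=
  congrArg (Term.func (L := arith) ArithFunc.zero) (funext fun i => i.elim0)

theorem substTm_numeral {n m : ℕ} (σ : Fin n → Tm m) (k : ℕ) :
    substTm σ (numeral k) = numeral k := by
  induction k with
  | zero => exact substTm_tzero σ
  | succ k ih => exact (substTm_tsucc σ _).trans (congrArg tsucc ih)

theorem substTm_liftSubst_weakenTm {n m : ℕ} (σ : Fin n → Tm m) (t : Tm n) :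
    substTm (liftSubst σ) (weakenTm t) = weakenTm (substTm σ t) := by
  simp only [weakenTm, substTm_substTm, substTm_tvar, liftSubst, Fin.snoc_castSucc]

theorem liftSubst_comp {n m l : ℕ} (σ : Fin n → Tm m) (ρ : Fin m → Tm l) :
    liftSubst (fun i => substTm ρ (σ i)) =
      fun i => substTm (liftSubst ρ) (liftSubst σ i) := by
  funext i
  refine Fin.lastCases ?_ (fun i => ?_) i
  · simp only [liftSubst, Fin.snoc_last, substTm_tvar]
  · rw [liftSubst, Fin.snoc_castSucc, ← substTm_liftSubst_weakenTm]
    simp only [liftSubst, Fin.snoc_castSucc]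

theorem liftSubst_id {n : ℕ} : liftSubst (tvar (n := n)) = tvar := by
  funext i
  refine Fin.lastCases ?_ (fun i => ?_) i
  · simp only [liftSubst, Fin.snoc_last]
  · simp only [liftSubst, Fin.snoc_castSucc, weakenTm, substTm_tvar]

theorem subst_subst {n m l : ℕ} (φ : Fm n) (σ : Fin n → Tm m) (ρ : Fin m → Tm l) :
    subst (subst φ σ) ρ = subst φ fun i => substTm ρ (σ i) := by
  induction φ generalizing m l with
  | falsum => rfl
  | equal t u => simp only [subst, substTm_substTm]
  | rel r ts => exact r.elim
  | imp φ ψ ihφ ihψ => simp only [subst, ihφ, ihψ]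
  | all φ ih => simp only [subst, ih, liftSubst_comp]

theorem subst_id {n : ℕ} (φ : Fm n) : subst φ tvar = φ := by
  induction φ with
  | falsum => rfl
  | equal t u => simp only [subst, substTm_id]
  | rel r ts => exact r.elim
  | imp φ ψ ihφ ihψ => simp only [subst, ihφ, ihψ]
  | all φ ih => simp only [subst, liftSubst_id, ih]

theorem subst_app {n m : ℕ} (ψ : Fm 1) (t : Tm n) (σ : Fin n → Tm m) :
    subst (app ψ t) σ = app ψ (substTm σ t) :=
  subst_subst _ _ _

theorem subst_iInf {β : Type*} [Finite β] {n m : ℕ} (f : β → Fm n) (σ : Fin n → Tm m) :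
    subst (BoundedFormula.iInf f) σ = BoundedFormula.iInf fun b => subst (f b) σ := by
  simp only [BoundedFormula.iInf]
  generalize Finset.toList _ = l
  induction l with
  | nil => rfl
  | cons b l ih => exact congrArg (fun χ => subst (f b) σ ⊓ χ) ih

theorem subst_iSup {β : Type*} [Finite β] {n m : ℕ} (f : β → Fm n) (σ : Fin n → Tm m) :
    subst (BoundedFormula.iSup f) σ = BoundedFormula.iSup fun b => subst (f b) σ := by
  simp only [BoundedFormula.iSup]
  generalize Finset.toList _ = l
  induction l with
  | nil => rfl
  | cons b l ih => exact congrArg (fun χ => subst (f b) σ ⊔ χ) ih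

/-! ### Propositional reasoning -/

namespace Proves

variable {T U : arith.Theory} {φ ψ χ : arith.Sentence}

theorem mono (h : Proves T φ) (hTU : T ⊆ U) : Proves U φ := by
  induction h with
  | ax h => exact .ax (hTU h)
  | logical h => exact .logical h
  | mp _ _ ih₁ ih₂ => exact .mp ih₁ ih₂

theorem imp_of (h : Proves T φ) : Proves T (ψ.imp φ) :=
  .mp (.logical (.imp_k (n := 0) φ ψ)) h

theorem imp_mp (h₁ : Proves T (χ.imp (φ.imp ψ))) (h₂ : Proves T (χ.imp φ)) :
    Proves T (χ.imp ψ) :=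
  .mp (.mp (.logical (.imp_s (n := 0) χ φ ψ)) h₁) h₂

theorem imp_self (T : arith.Theory) (φ : arith.Sentence) : Proves T (φ.imp φ) :=
  imp_mp (.logical (.imp_k (n := 0) φ (φ.imp φ))) (.logical (.imp_k (n := 0) φ φ))

/-- The deduction theorem. -/
theorem deduction (h : Proves (T ∪ {ψ}) φ) : Proves T (ψ.imp φ) := by
  induction h with
  | ax h =>
    rcases h with h | h
    · exact imp_of (.ax h)
    · rw [Set.mem_singleton_iff.1 h]
      exact imp_self T _
  | logical h => exact imp_of (.logical h)
  | mp _ _ ih₁ ih₂ => exact imp_mp ih₁ ih₂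

theorem cut (h : Proves (T ∪ {ψ}) φ) (hψ : Proves T ψ) : Proves T φ :=
  .mp h.deduction hψ

theorem weaken_union (h : Proves T φ) : Proves (T ∪ {ψ}) φ :=
  h.mono Set.subset_union_left

theorem assumption : Proves (T ∪ {φ}) φ := .ax (Or.inr rfl)

theorem by_contradiction (h : Proves (T ∪ {φ.not}) ⊥) : Proves T φ :=
  .mp (.logical (.dne (n := 0) φ)) h.deduction

theorem and_intro (h₁ : Proves T φ) (h₂ : Proves T ψ) :
    Proves T (φ ⊓ ψ : arith.BoundedFormula Empty 0) :=
  -- The conjunction unfolds to (φ → ¬ψ) → ⊥.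
  deduction (φ := (⊥ : arith.BoundedFormula Empty 0))
    (.mp (.mp assumption h₁.weaken_union) h₂.weaken_union)

theorem iInf_intro {β : Type*} [Finite β] {f : β → Fm 0} (h : ∀ b, Proves T (f b)) :
    Proves T (BoundedFormula.iInf f) := by
  simp only [BoundedFormula.iInf]
  generalize Finset.toList _ = l
  induction l with
  | nil => exact imp_self T _
  | cons b l ih => exact and_intro (h b) ih

theorem iSup_elim {β : Type*} [Finite β] {f : β → Fm 0} (h : ∀ b, Proves T (f b).not)
    (hf : Proves T (BoundedFormula.iSup f)) : Proves T (⊥ : arith.BoundedFormula Empty 0) := by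
  simp only [BoundedFormula.iSup] at hf
  generalize Finset.toList _ = l at hf
  induction l with
  | nil => exact hf
  -- A disjunction unfolds to ¬b → rest, so refuting b leaves the rest.
  | cons b l ih => exact ih (.mp hf (h b))

/-! ### Instantiation of universal closures -/

/-- Modus ponens under a block of quantifiers: `all_imp` distributes the innermost one, and the
induction hypothesis handles the outer ones. -/
theorem alls_mp {n : ℕ} {φ ψ : Fm n} (h : Proves T (φ.imp ψ).alls) (hφ : Proves T φ.alls) :
    Proves T ψ.alls := by
  induction n with
  | zero => exact .mp h hφ
  | succ n ih => exact ih (ih (.logical (.all_imp φ ψ)) h) hφ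

/-- The innermost quantifier is instantiated first, under the remaining closure. Numerals are
closed, so later substitutions leave them unchanged and the successive instantiations amount to one
simultaneous substitution. -/
theorem subst_numeral {n : ℕ} {φ : Fm n} (h : Proves T φ.alls) (a : Fin n → ℕ) :
    Proves T (subst φ fun i => numeral (a i)) := by
  induction n with
  | zero =>
    rw [show (fun i => numeral (a i)) = tvar (n := 0) from funext fun i => i.elim0, subst_id]
    exact h
  | succ n ih =>
    have h' := ih (alls_mp (.logical (.all_inst φ (numeral (a (Fin.last n))))) h)
      fun i => a i.castSucc
    rw [inst, subst_subst] at h'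
    convert h' using 2
    funext i
    refine Fin.lastCases ?_ (fun i => ?_) i
    · simp only [Fin.snoc_last, substTm_numeral]
    · simp only [Fin.snoc_castSucc, substTm_tvar]

end Proves

/-! ### Numerals -/

/-- Injectivity of S strips successors from both sides until the smaller numeral is 0. -/
theorem proves_numeral_ne {a b : ℕ} (h : b < a) :
    Proves PA ((numeral (n := 0) a).bdEqual (numeral b)).not := by
  induction b generalizing a with
  | zero =>
    obtain ⟨a, rfl⟩ := Nat.exists_eq_succ_of_ne_zero h.ne'
    have := Proves.subst_numeral (.ax PAAxiom.succ_ne_zero) ![a]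
    simp only [Term.bdEqual, subst, substTm_tsucc, substTm_tzero, substTm_tvar] at this
    exact this
  | succ b ih =>
    obtain ⟨a, rfl⟩ := Nat.exists_eq_succ_of_ne_zero (Nat.ne_zero_of_lt h)
    have := Proves.subst_numeral (.ax PAAxiom.succ_inj) ![a, b]
    simp only [Term.bdEqual, subst, substTm_tsucc, substTm_tvar] at this
    exact Proves.deduction (φ := (⊥ : arith.BoundedFormula Empty 0))
      (.mp (ih (Nat.lt_of_succ_lt_succ h)).weaken_union (.mp this.weaken_union .assumption))

/-- If more than `k` numerals provably satisfy `ψ`, then “at most `k` numbers satisfy `ψ`” is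
refutable. -/
theorem proves_bot_of_atMost {T : arith.Theory} (hT : PA ⊆ T) {k : ℕ} {ψ : Fm 1} {B : Finset ℕ}
    (hB : k < B.card) (hψ : ∀ n ∈ B, Proves T (app ψ (numeral n)))
    (h : Proves T (atMost k ψ)) : Proves T (⊥ : arith.BoundedFormula Empty 0) := by
  obtain ⟨C, hCB, hC⟩ := Finset.exists_subset_card_eq (Nat.succ_le_of_lt hB)
  -- The enumeration is decreasing, so that i < j gives a i > a j: the larger numeral stands on the
  -- left, as in `proves_numeral_ne`, and symmetry of equality is not needed.
  let a : Fin (k + 1) → ℕ := fun i => C.orderEmbOfFin hC i.rev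
  have h' := Proves.subst_numeral h a
  rw [subst, subst_iInf, subst_iSup] at h'
  refine Proves.iSup_elim (fun p => ?_) (.mp h' (Proves.iInf_intro fun i => ?_))
  · exact (proves_numeral_ne ((C.orderEmbOfFin hC).strictMono (Fin.rev_lt_rev.2 p.2))).mono hT
  · rw [subst_app]
    exact hψ _ (hCB (C.orderEmbOfFin_mem hC _))

/-- If `φ` follows from each of more than `τ · #A` of the sentences `R(n)`, `n ∈ A`, then it
follows from `(∀_τ x ∈ A) R(x)`. -/
theorem Proves.of_mostlyAll {T : arith.Theory} (hT : PA ⊆ T) {A B : Finset ℕ} {α R : Fm 1}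
    (hα : Represents α A) {τ : ℚ} (hτ : 0 ≤ τ) (hBA : B ⊆ A)
    (hB : τ * (A.card : ℚ) < (B.card : ℚ)) {φ : arith.Sentence}
    (hR : ∀ n ∈ B, Proves (T ∪ {app R (numeral n)}) φ) (h : Proves T (mostlyAll τ A α R)) :
    Proves T φ := by
  -- Work in T + ¬φ, where every n ∈ B is a provable counterexample to R in A, and #B exceeds the
  -- permitted ⌊τ·#A⌋.
  refine by_contradiction (proves_bot_of_atMost (hT.trans Set.subset_union_left)
    ((Nat.floor_lt (by positivity)).2 hB) (fun n hn => ?_) h.weaken_union)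
  refine and_intro ((hα.proves_mem n (hBA hn)).mono (hT.trans Set.subset_union_left)) ?_
  exact deduction (φ := (⊥ : arith.BoundedFormula Empty 0))
    (.mp assumption.weaken_union (.mp (hR n hn).deduction.weaken_union.weaken_union assumption))

/-! ### Probabilities -/

/-- If the average of numbers `p n ≤ 1` exceeds `δ`, then more than a fraction `τ` of them
exceed `δ - τ`. -/
theorem lt_card_filter_of_lt_average {ι : Type*} [Fintype ι] [Nonempty ι] {p : ι → ENNReal}
    (hp : ∀ i, p i ≤ 1) {τ δ : ℚ} (hτδ : τ ≤ δ)
    (h : ENNReal.ofReal (δ : ℝ) < ∑ i, (Fintype.card ι : ENNReal)⁻¹ * p i)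
    [DecidablePred fun i => ENNReal.ofReal ((δ - τ : ℚ) : ℝ) < p i] :
    τ * (Fintype.card ι : ℚ) <
      ((Finset.univ.filter fun i => ENNReal.ofReal ((δ - τ : ℚ) : ℝ) < p i).card : ℚ) := by
  classical
  by_contra! hB
  set B := Finset.univ.filter fun i => ENNReal.ofReal ((δ - τ : ℚ) : ℝ) < p i
  have hδτ : (0 : ℝ) ≤ ((δ - τ : ℚ) : ℝ) := by exact_mod_cast sub_nonneg.2 hτδ
  -- Pointwise p ≤ 1_B + (δ - τ), and #B ≤ τ·#ι by assumption, so the sum is at most δ·#ι.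
  have hsum : ∑ i, p i ≤ (Fintype.card ι : ENNReal) * ENNReal.ofReal (δ : ℝ) := by
    calc ∑ i, p i
        ≤ ∑ i, ((if i ∈ B then 1 else 0) + ENNReal.ofReal ((δ - τ : ℚ) : ℝ)) := by
          refine Finset.sum_le_sum fun i _ => ?_
          split_ifs with hi
          · exact (hp i).trans le_self_add
          · rw [zero_add]
            exact not_lt.1 fun hlt => hi (Finset.mem_filter.2 ⟨Finset.mem_univ i, hlt⟩)
      _ = ENNReal.ofReal ((B.card : ℝ) + (Fintype.card ι : ℝ) * ((δ - τ : ℚ) : ℝ)) := by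
          rw [Finset.sum_add_distrib, Finset.sum_boole, Finset.sum_const, Finset.card_univ,
            nsmul_eq_mul, ENNReal.ofReal_add (by positivity) (by positivity),
            ENNReal.ofReal_mul (by positivity), ENNReal.ofReal_natCast, ENNReal.ofReal_natCast,
            Finset.filter_mem_eq_inter, Finset.univ_inter]
      _ ≤ ENNReal.ofReal ((Fintype.card ι : ℝ) * (δ : ℝ)) := by
          refine ENNReal.ofReal_le_ofReal ?_
          have hB' : (B.card : ℝ) ≤ (τ : ℝ) * (Fintype.card ι : ℝ) := by exact_mod_cast hB
          push_cast
          linarith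
      _ = (Fintype.card ι : ENNReal) * ENNReal.ofReal (δ : ℝ) := by
          rw [ENNReal.ofReal_mul (by positivity), ENNReal.ofReal_natCast]
  rw [← Finset.mul_sum] at h
  refine absurd (h.trans_le (mul_le_mul_right hsum _)) ?_
  rw [← mul_assoc, ENNReal.inv_mul_cancel (by simp) (by simp), one_mul]
  exact lt_irrefl _

/-! ### Induction on proof strategies -/

namespace Strategy

variable {T : arith.Theory} {δ : ℚ}

theorem probProves_le_one (π : Strategy T δ) (φ : arith.Sentence) : π.probProves φ ≤ 1 := by
  rw [probProves, PMF.toOuterMeasure_apply]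
  refine le_of_le_of_eq (ENNReal.tsum_le_tsum fun U => ?_) π.builtTheory.tsum_coe
  exact Set.indicator_le_self _ _ _

theorem probProves_probabilistic (A : Finset ℕ) (hA : A.Nonempty) (α R : Fm 1)
    (hα : Represents α A) (τ : ℚ) (hτ : 0 ≤ τ) (hτδ : τ ≤ δ) (hT : mostlyAll τ A α R ∈ T)
    (child : ∀ n : A, Strategy (T ∪ {app R (numeral n)}) (δ - τ)) (φ : arith.Sentence) :
    (probabilistic A hA α R hα τ hτ hτδ hT child).probProves φ =
      ∑ n : A, (Fintype.card A : ENNReal)⁻¹ * (child n).probProves φ := by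
  rw [probProves, builtTheory, PMF.toOuterMeasure_bind_apply, tsum_fintype]
  simp only [PMF.uniformOfFintype_apply, probProves]

/-- A strategy starting from a theory `T ⊇ PA` with capital `δ` proves with probability greater
than `δ` only theorems of `T`. -/
theorem proves_of_lt_probProves (π : Strategy T δ) (hT : PA ⊆ T) (hδ : 0 ≤ δ)
    {φ : arith.Sentence} (h : ENNReal.ofReal (δ : ℝ) < π.probProves φ) : Proves T φ := by
  classical
  induction π with
  | leaf T δ =>
    rw [probProves, builtTheory, PMF.toOuterMeasure_pure_apply] at h
    split_ifs at h with hφ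
    · exact .ax hφ
    · exact absurd h not_lt_zero
  | deterministic ψ hψ child ih =>
    refine (ih (hT.trans Set.subset_union_left) hδ h).cut ?_
    rcases hψ with hψ | ⟨χ, hχ, hχψ⟩
    · exact .logical hψ
    · exact .mp (.ax hχψ) (.ax hχ)
  | @probabilistic T δ A hA α R hα τ hτ hτδ hmem child ih =>
    have : Nonempty A := hA.to_subtype
    rw [probProves_probabilistic] at h
    have hlt := lt_card_filter_of_lt_average (fun n => (child n).probProves_le_one φ) hτδ h
    -- The good children form a set in the subtype of A; its image in ℕ has the same size.
    rw [Fintype.card_coe, ← Finset.card_map (Function.Embedding.subtype _)] at hlt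
    refine Proves.of_mostlyAll hT hα hτ (Finset.map_subtype_subset _) hlt (fun n hn => ?_)
      (.ax hmem)
    obtain ⟨m, hm, rfl⟩ := Finset.mem_map.1 hn
    exact ih m (hT.trans Set.subset_union_left) (sub_nonneg.2 hτδ) (Finset.mem_filter.1 hm).2

end Strategy

end RandomAxioms

/-- A probabilistic proof strategy with initial capital `ε` that proves a fixed sentence `φ` with
probability greater than `ε` exists only for sentences provable in `PA`. -/
theorem theorem2 (φ : FirstOrder.Language.Sentence RandomAxioms.arith) (ε : ℚ) (hε : 0 ≤ ε)
    (π : RandomAxioms.Strategy RandomAxioms.PA ε)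
    (h : ENNReal.ofReal (ε : ℝ) < π.probProves φ) :
    RandomAxioms.Proves RandomAxioms.PA φ := by
  exact π.proves_of_lt_probProves subset_rfl hε h
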